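/- Let $m\in\{1,2,3,\dots\}$, let $p\in(0,\infty)$, let $\lambda$ be Lebesgue measure on $\mathbb{R}^m$, and let $X\subset\mathbb{R}^m$ be Lebesgue measurable. Let $\mathbb{K}$ be $\mathbb{R}$ or $\mathbb{C}$, and for $q\in(0,\infty]$ let $L_q(X)$ be the space of (classes modulo $\lambda$-a.e. equality of) measurable functions $f\colon X\to\mathbb{K}$ with $\|f\|_q<\infty$; $L_p(X)$ carries its usual topology, in which the balls $\{g:\|g-f\|_p<\varepsilon\}$, $\varepsilon>0$, form a basis of neighbourhoods of $f$. Put $$A:=L_p(X)\smallsetminus\bigcup_{q\in(p,\infty]}L_q(X)\subset L_p(X),$$ and write $\mathfrak{c}=\operatorname{card}(\mathbb{R})$, $\aleph_0=\operatorname{card}(\mathbb{N})$. For cardinals $\alpha<\beta$, a subset $B$ of a topological vector space $E$ is called - *$\beta$-lineable* if there is a vector subspace $F\subset E$ with $\dim F=\beta$ and $F\smallsetminus\{0\}\subset B$; - *$\beta$-spaceable* if $B\cup\{0\}$ contains a closed vector subspace of $E$ of dimension $\beta$; - *$(\alpha,\beta)$-spaceable* if it is $\alpha$-lineable and for every vector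 subspace $F_\alpha\subset E$ with $F_\alpha\subset B\cup\{0\}$ and $\dim F_\alpha=\alpha$ there is a closed vector subspace $F_\beta\subset E$ with $\dim F_\beta=\beta$ and $F_\alpha\subset F_\beta\subset B\cup\{0\}$. The following statements are equivalent: (a) $\lambda(X)>0$; (b) $A$ is $(n,\mathfrak{c})$-spaceable for some $n<\aleph_0$; (c) $A$ is $(\alpha,\mathfrak{c})$-spaceable for all $\alpha<\aleph_0$; (d) $A$ is $\mathfrak{c}$-spaceable; (e) $A$ is $\mathfrak{c}$-lineable. -/

import Mathlib

open MeasureTheory Cardinal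
open scoped ENNReal

/-- A subset `A` of a `K`-vector space `E` is `β`-lineable: `A ∪ {0}` contains a vector subspace
of dimension exactly `β`. -/
def IsCardLineable (K : Type*) {E : Type*} [Field K] [AddCommGroup E] [Module K E]
    (β : Cardinal) (A : Set E) : Prop :=
  ∃ F : Submodule K E, Module.rank K F = β ∧ (F : Set E) \ {0} ⊆ A

/-- A subset `A` of a topological vector space `E` is `β`-spaceable: `A ∪ {0}` contains a closed
vector subspace of dimension exactly `β`. -/
def IsCardSpaceable (K : Type*) {E : Type*} [Field K] [AddCommGroup E] [Module K E]
    [TopologicalSpace E] (β : Cardinal) (A : Set E) : Prop :=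
  ∃ F : Submodule K E, Module.rank K F = β ∧ IsClosed (F : Set E) ∧ (F : Set E) ⊆ A ∪ {0}

/-- A subset `A` of a topological vector space `E` is `(α, β)`-spaceable: it is `α`-lineable, and
every `α`-dimensional subspace contained in `A ∪ {0}` is contained in a closed `β`-dimensional
subspace that is itself contained in `A ∪ {0}`. -/
def IsPairSpaceable (K : Type*) {E : Type*} [Field K] [AddCommGroup E] [Module K E]
    [TopologicalSpace E] (α β : Cardinal) (A : Set E) : Prop :=
  IsCardLineable K α A ∧
    ∀ Fα : Submodule K E, (Fα : Set E) ⊆ A ∪ {0} → Module.rank K Fα = α →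
      ∃ Fβ : Submodule K E, Module.rank K Fβ = β ∧ IsClosed (Fβ : Set E) ∧
        Fα ≤ Fβ ∧ (Fβ : Set E) ⊆ A ∪ {0}

section LpTopology

variable {Ω : Type*} [MeasurableSpace Ω]

/-- The usual topology of `L_p(μ)`, for every exponent `p`, including `0 < p < 1` where the
`p`-quasinorm is not a norm: a set is open if around each of its points it contains a ball
`{g | ‖g - f‖_p < ε}`. Mathlib equips `Lp` with a topology only for `1 ≤ p`; the two then agree,
see `lpTopology_eq`. -/
@[reducible] def lpTopology (K : Type*) [RCLike K] (p : ℝ≥0∞) (μ : Measure Ω) :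
    TopologicalSpace (Lp K p μ) where
  IsOpen U := ∀ f ∈ U, ∃ ε : ℝ≥0∞, 0 < ε ∧ ∀ g : Lp K p μ, eLpNorm (⇑(g - f)) p μ < ε → g ∈ U
  isOpen_univ := fun _ _ => ⟨1, one_pos, fun _ _ => Set.mem_univ _⟩
  isOpen_inter := by
    rintro U V hU hV f ⟨hfU, hfV⟩
    obtain ⟨ε, hε, h⟩ := hU f hfU
    obtain ⟨δ, hδ, h'⟩ := hV f hfV
    exact ⟨min ε δ, lt_min hε hδ, fun g hg =>
      ⟨h g (hg.trans_le (min_le_left _ _)), h' g (hg.trans_le (min_le_right _ _))⟩⟩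
  isOpen_sUnion := by
    rintro S hS f ⟨U, hU, hfU⟩
    obtain ⟨ε, hε, h⟩ := hS U hU f hfU
    exact ⟨ε, hε, fun g hg => ⟨U, hU, h g hg⟩⟩

/-- The balls of the `p`-quasinorm form a basis of neighbourhoods for `lpTopology`. -/
theorem lpTopology_mem_nhds (K : Type*) [RCLike K] (p : ℝ≥0∞) (μ : Measure Ω)
    (f : Lp K p μ) (s : Set (Lp K p μ)) :
    s ∈ @nhds _ (lpTopology K p μ) f ↔
      ∃ ε : ℝ≥0∞, 0 < ε ∧ ∀ g : Lp K p μ, eLpNorm (⇑(g - f)) p μ < ε → g ∈ s := by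
  let _ := lpTopology K p μ
  constructor
  · intro h
    obtain ⟨U, hUs, hU, hfU⟩ := mem_nhds_iff.1 h
    obtain ⟨ε, hε, h⟩ := hU f hfU
    exact ⟨ε, hε, fun g hg => hUs (h g hg)⟩
  · rintro ⟨ε, hε, h⟩
    refine mem_nhds_iff.2 ⟨{u | ∃ δ : ℝ≥0∞, 0 < δ ∧
      ∀ g : Lp K p μ, eLpNorm (⇑(g - u)) p μ < δ → g ∈ s}, ?_, ?_, ⟨ε, hε, h⟩⟩
    · rintro u ⟨δ, hδ, hu⟩
      apply hu u
      rw [sub_self, eLpNorm_congr_ae (Lp.coeFn_zero K p μ)]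
      simpa using hδ
    · rintro u ⟨δ, hδ, hu⟩
      obtain ⟨η, hη, hadd⟩ := exists_Lp_half (ε := K) μ p hδ.ne'
      refine ⟨η, hη, fun v hv => ⟨η, hη, fun g hg => hu g ?_⟩⟩
      have e : g - u = (g - v) + (v - u) := by abel
      rw [e, eLpNorm_congr_ae (Lp.coeFn_add _ _)]
      exact hadd _ _ (Lp.aestronglyMeasurable _) (Lp.aestronglyMeasurable _) hg.le hv.le

theorem lpTopology_eq (K : Type*) [RCLike K] (p : ℝ≥0∞) [Fact (1 ≤ p)] (μ : Measure Ω) :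
    lpTopology K p μ = (inferInstance : TopologicalSpace (Lp K p μ)) := by
  refine TopologicalSpace.ext_nhds fun f => ?_
  ext s
  rw [lpTopology_mem_nhds, EMetric.mem_nhds_iff]
  refine exists_congr fun ε => and_congr_right fun _ => forall_congr' fun g => ?_
  rw [Metric.mem_eball, Lp.edist_def, eLpNorm_congr_ae (Lp.coeFn_sub g f)]

end LpTopology

/-- The set `L_p(μ) ∖ ⋃_{q ∈ (p, ∞]} L_q(μ)`, as a subset of `L_p(μ)`. -/
def lpMinusUnion {Ω : Type*} [MeasurableSpace Ω] (K : Type*) [RCLike K] (p : ℝ≥0∞)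
    (μ : Measure Ω) : Set (Lp K p μ) :=
  {f | (f : Ω →ₘ[μ] K) ∉ ⋃ q ∈ Set.Ioi p, (Lp K q μ : Set (Ω →ₘ[μ] K))}

/-! If `X` is null, `L_p(X)` is zero and has no subspace of dimension `𝔠`. Otherwise, let `F` be a
finite dimensional subspace of `A ∪ {0}`. Its finitely many generators are bounded on a common set
`B` of positive measure, hence so is each member of `F`. Inside `B` one builds `g` in `L_p` and
disjoint blocks, such that `g` restricted to any block lies in no `L_q` with `q > p`
(`exists_memLp_forall_not_memLp_indicator`). The functions `u` that are a multiple of `g` on each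
block and vanish elsewhere form a closed space of dimension `𝔠`, and adding `F` keeps it closed. If
`u + f` is in `L_q` with `f ∈ F`, then `f` is in `L_q` off the blocks, where `u = 0`, and on them,
where `f` is bounded. So `f = 0`, and then every coefficient of `u` vanishes
(`sup_blockSubspace_subset`). -/

/-! ### The vector space topology of `L_p`, for all exponents. -/

section LpVectorTopology

variable {Ω : Type*} [MeasurableSpace Ω] (K : Type*) [RCLike K] (p : ℝ≥0∞) (μ : Measure Ω)

open Filter Topology

/-- The balls of the `p`-quasinorm around zero form a basis of neighbourhoods of zero. -/
theorem lpTopology_mem_nhds_zero (s : Set (Lp K p μ)) :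
    s ∈ @nhds _ (lpTopology K p μ) 0 ↔
      ∃ ε : ℝ≥0∞, 0 < ε ∧ ∀ g : Lp K p μ, eLpNorm g p μ < ε → g ∈ s := by
  simp_rw [lpTopology_mem_nhds, sub_zero]

/-- With the Hausdorff property and continuity of scalar multiplication, this makes finite
dimensional subspaces closed even for `p < 1`. `exists_Lp_half` stands in for the triangle
inequality. -/
theorem lpTopology_isTopologicalAddGroup :
    @IsTopologicalAddGroup (Lp K p μ) (lpTopology K p μ) _ := by
  let _ := lpTopology K p μ
  refine IsTopologicalAddGroup.of_comm_of_nhds_zero ?_ ?_ fun f => ?_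
  · intro s hs
    obtain ⟨ε, hε, h⟩ := (lpTopology_mem_nhds_zero K p μ s).1 hs
    obtain ⟨η, hη, hadd⟩ := exists_Lp_half (ε := K) μ p hε.ne'
    have hb : {g : Lp K p μ | eLpNorm g p μ < η} ∈ 𝓝 (0 : Lp K p μ) :=
      (lpTopology_mem_nhds_zero K p μ _).2 ⟨η, hη, fun _ => id⟩
    refine mem_map.2 (mem_of_superset (prod_mem_prod hb hb) ?_)
    rintro ⟨u, v⟩ ⟨hu, hv⟩
    refine h _ ?_
    change eLpNorm (⇑(u + v)) p μ < ε
    rw [eLpNorm_congr_ae (Lp.coeFn_add _ _)]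
    exact hadd _ _ (Lp.aestronglyMeasurable _) (Lp.aestronglyMeasurable _) (le_of_lt hu)
      (le_of_lt hv)
  · intro s hs
    obtain ⟨ε, hε, h⟩ := (lpTopology_mem_nhds_zero K p μ s).1 hs
    refine (lpTopology_mem_nhds_zero K p μ _).2 ⟨ε, hε, fun g hg => h _ ?_⟩
    rwa [eLpNorm_congr_ae (Lp.coeFn_neg _), eLpNorm_neg]
  · ext s
    rw [mem_map, lpTopology_mem_nhds, lpTopology_mem_nhds_zero]
    refine exists_congr fun ε => and_congr_right fun _ => ⟨fun h g hg => ?_, fun h g hg => ?_⟩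
    · exact h _ (by rwa [add_sub_cancel_left])
    · have := h _ hg
      rwa [Set.mem_preimage, add_sub_cancel] at this

theorem lpTopology_t2Space (hp : p ≠ 0) : @T2Space (Lp K p μ) (lpTopology K p μ) := by
  let _ := lpTopology K p μ
  have _ := lpTopology_isTopologicalAddGroup K p μ
  refine IsTopologicalAddGroup.t2Space_of_zero_sep fun f hf => ?_
  refine ⟨{g | eLpNorm g p μ < eLpNorm f p μ}, (lpTopology_mem_nhds_zero K p μ _).2
    ⟨eLpNorm f p μ, ?_, fun _ => id⟩, lt_irrefl (eLpNorm f p μ)⟩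
  rw [pos_iff_ne_zero]
  intro h0
  exact hf (Lp.eq_zero_iff_ae_eq_zero.2
    ((eLpNorm_eq_zero_iff (Lp.aestronglyMeasurable f) hp).1 h0))

theorem lpTopology_continuousSMul :
    @ContinuousSMul K (Lp K p μ) _ _ (lpTopology K p μ) := by
  let _ := lpTopology K p μ
  have _ := lpTopology_isTopologicalAddGroup K p μ
  have key : ∀ (a : K) (f : Lp K p μ), eLpNorm (⇑(a • f)) p μ = ‖a‖ₑ * eLpNorm f p μ := by
    intro a f
    rw [eLpNorm_congr_ae (Lp.coeFn_smul a f), eLpNorm_const_smul]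
  refine ContinuousSMul.of_nhds_zero ?_ ?_ ?_
  · intro s hs
    obtain ⟨ε, hε, h⟩ := (lpTopology_mem_nhds_zero K p μ s).1 hs
    have hb : {g : Lp K p μ | eLpNorm g p μ < ε} ∈ 𝓝 (0 : Lp K p μ) :=
      (lpTopology_mem_nhds_zero K p μ _).2 ⟨ε, hε, fun _ => id⟩
    refine mem_map.2 (mem_of_superset (prod_mem_prod (Metric.ball_mem_nhds (0 : K) one_pos) hb) ?_)
    rintro ⟨a, f⟩ ⟨ha, hf⟩
    refine h _ ?_
    change eLpNorm (⇑(a • f)) p μ < ε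
    rw [key]
    refine lt_of_le_of_lt (mul_le_of_le_one_left' ?_) hf
    rw [← ofReal_norm, ENNReal.ofReal_le_one]
    exact (mem_ball_zero_iff.1 ha).le
  · intro f s hs
    obtain ⟨ε, hε, h⟩ := (lpTopology_mem_nhds_zero K p μ s).1 hs
    have : Tendsto (fun a : K => ‖a‖ₑ * eLpNorm f p μ) (𝓝 0) (𝓝 0) := by
      have h1 : Tendsto (fun a : K => ‖a‖ₑ) (𝓝 0) (𝓝 0) := by
        simpa using (continuous_enorm (E := K)).tendsto 0
      simpa using ENNReal.Tendsto.mul_const h1 (Or.inr (Lp.eLpNorm_ne_top f))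
    rw [mem_map]
    filter_upwards [this (Iio_mem_nhds hε)] with a ha
    exact h _ (by rw [key]; exact ha)
  · intro a s hs
    obtain ⟨ε, hε, h⟩ := (lpTopology_mem_nhds_zero K p μ s).1 hs
    refine (lpTopology_mem_nhds_zero K p μ _).2
      ⟨ε / ‖a‖ₑ, ENNReal.div_pos hε.ne' enorm_ne_top, fun g hg => h _ ?_⟩
    rw [key, mul_comm]
    exact ENNReal.mul_lt_of_lt_div hg

variable {p μ} in
/-- Multiplication by the indicator function of a measurable set, on `L_p`. -/
noncomputable def lpIndicator {S : Set Ω} (hS : MeasurableSet S) : Lp K p μ →ₗ[K] Lp K p μ where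
  toFun f := ((Lp.memLp f).indicator hS).toLp _
  map_add' f g := by
    refine Lp.ext ?_
    filter_upwards [Lp.coeFn_add (((Lp.memLp f).indicator hS).toLp _)
      (((Lp.memLp g).indicator hS).toLp _), Lp.coeFn_add f g,
      ((Lp.memLp f).indicator hS).coeFn_toLp, ((Lp.memLp g).indicator hS).coeFn_toLp,
      ((Lp.memLp (f + g)).indicator hS).coeFn_toLp] with x h1 h2 h3 h4 h5
    rw [h5, h1, Pi.add_apply, h3, h4]
    by_cases hx : x ∈ S
    · simp only [Set.indicator_of_mem hx, h2, Pi.add_apply]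
    · simp [hx]
  map_smul' a f := by
    refine Lp.ext ?_
    filter_upwards [Lp.coeFn_smul a (((Lp.memLp f).indicator hS).toLp _), Lp.coeFn_smul a f,
      ((Lp.memLp f).indicator hS).coeFn_toLp,
      ((Lp.memLp (a • f)).indicator hS).coeFn_toLp] with x h1 h2 h3 h4
    rw [h4, RingHom.id_apply, h1, Pi.smul_apply, h3]
    by_cases hx : x ∈ S
    · simp only [Set.indicator_of_mem hx, h2, Pi.smul_apply]
    · simp [hx]

variable {K p μ} in
theorem coeFn_lpIndicator {S : Set Ω} (hS : MeasurableSet S) (f : Lp K p μ) :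
    ⇑(lpIndicator K hS f) =ᵐ[μ] S.indicator f :=
  ((Lp.memLp f).indicator hS).coeFn_toLp

theorem continuous_lpIndicator {S : Set Ω} (hS : MeasurableSet S) :
    @Continuous _ _ (lpTopology K p μ) (lpTopology K p μ) (lpIndicator K (p := p) (μ := μ) hS) := by
  let _ := lpTopology K p μ
  have _ := lpTopology_isTopologicalAddGroup K p μ
  refine continuous_of_continuousAt_zero (lpIndicator K (p := p) (μ := μ) hS) ?_
  intro s hs
  rw [map_zero] at hs
  obtain ⟨ε, hε, h⟩ := (lpTopology_mem_nhds_zero K p μ s).1 hs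
  refine (lpTopology_mem_nhds_zero K p μ _).2 ⟨ε, hε, fun g hg => h _ ?_⟩
  rw [eLpNorm_congr_ae (coeFn_lpIndicator hS g)]
  exact (eLpNorm_indicator_le _).trans_lt hg

end LpVectorTopology

/-! ### Construction of a function in no `L_q` on any block. -/

section UnboundedFunctions

open Filter Topology

variable {Ω : Type*} [MeasurableSpace Ω] {μ : Measure Ω}

/-- In a nonatomic σ-finite measure space over a metric space, a set of positive measure contains
the pairwise disjoint positive level sets of an `ℕ`-valued function, of positive measure as small as
desired. -/
theorem exists_measurable_nat_measure_fiber_le [MetricSpace Ω] [SecondCountableTopology Ω]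
    [BorelSpace Ω] [SigmaFinite μ] [NullSingletonClass μ] {B : Set Ω} (hB : MeasurableSet B)
    (hμB : μ B ≠ 0) (δ : ℕ → ℝ≥0∞) (hδ : ∀ n, 0 < δ n) :
    ∃ N : Ω → ℕ, Measurable N ∧ (∀ x, N x ≠ 0 → x ∈ B) ∧
      ∀ n, 0 < μ (N ⁻¹' {n + 1}) ∧ μ (N ⁻¹' {n + 1}) ≤ δ n := by
  obtain ⟨C, hC, hCB, hC0, hCtop⟩ := Measure.exists_subset_measure_lt_top hB
    (pos_iff_ne_zero.2 hμB)
  obtain ⟨x₀, -, hx₀⟩ := exists_mem_forall_mem_nhdsWithin_pos_measure (μ := μ) (s := C) hC0.ne'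
  -- The level sets of `d` are shells around `x₀`, every neighbourhood of which meets `C` in
  -- positive measure. As `{x₀}` is null, infinitely many shells have positive measure; as `μ C` is
  -- finite, these measures tend to zero.
  let d : Ω → ℕ := fun x => ⌊(dist x x₀)⁻¹⌋₊
  have hd : Measurable d := Nat.measurable_floor.comp (measurable_id.dist measurable_const).inv
  let ν : ℕ → ℝ≥0∞ := fun k => μ (d ⁻¹' {k} ∩ C)
  have hdm : ∀ k, MeasurableSet (d ⁻¹' {k} ∩ C) := fun k => (hd (measurableSet_singleton k)).inter hC
  have hdisj : Pairwise (Function.onFun Disjoint fun k => d ⁻¹' {k} ∩ C) := by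
    intro i j hij
    refine Set.disjoint_left.2 ?_
    rintro x ⟨hx, -⟩ ⟨hx', -⟩
    exact hij (hx.symm.trans hx')
  have hν : Tendsto ν atTop (𝓝 0) := by
    refine ENNReal.tendsto_atTop_zero_of_tsum_ne_top (ne_top_of_le_ne_top hCtop.ne ?_)
    rw [← measure_iUnion hdisj hdm]
    exact measure_mono (Set.iUnion_subset fun k => Set.inter_subset_right)
  have hfreq : ∃ᶠ k in atTop, 0 < ν k := by
    rw [frequently_atTop]
    intro k
    by_contra! hcon
    have h1 : 0 < μ (C ∩ Metric.ball x₀ ((k : ℝ) + 1)⁻¹) :=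
      hx₀ _ (inter_mem_nhdsWithin _ (Metric.ball_mem_nhds _ (by positivity)))
    refine h1.ne' (measure_mono_null (t := {x₀} ∪ ⋃ j, d ⁻¹' {k + j} ∩ C) ?_ ?_)
    · rintro x ⟨hxC, hx⟩
      by_cases hxx : x = x₀
      · exact Or.inl hxx
      · right
        have hpos : 0 < dist x x₀ := dist_pos.2 hxx
        have hk : k ≤ d x := by
          refine Nat.le_floor ?_
          rw [Metric.mem_ball, lt_inv_comm₀ hpos (by positivity)] at hx
          linarith
        exact Set.mem_iUnion.2 ⟨d x - k, by simp; omega, hxC⟩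
    · refine measure_union_null (measure_singleton x₀) (measure_iUnion_null fun j => ?_)
      exact le_antisymm (hcon (k + j) (Nat.le_add_right _ _)) zero_le
  obtain ⟨φ, hφ, hP⟩ := extraction_forall_of_frequently (P := fun n k => 0 < ν k ∧ ν k ≤ δ n)
    fun n => hfreq.and_eventually (hν.eventually_le_const (hδ n))
  classical
  -- The selected shell `φ n` gets the label `n + 1`, every other shell the label `0`.
  let e : ℕ → ℕ := Function.extend φ Nat.succ 0
  refine ⟨C.indicator fun x => e (d x), ((measurable_from_nat (f := e)).comp hd).indicator hC, ?_, ?_⟩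
  · intro x hx
    exact hCB (Set.mem_of_indicator_ne_zero hx)
  · intro n
    have : (C.indicator fun x => e (d x)) ⁻¹' {n + 1} = d ⁻¹' {φ n} ∩ C := by
      ext x
      simp only [Set.mem_preimage, Set.mem_singleton_iff, Set.mem_inter_iff]
      by_cases hx : x ∈ C
      · simp only [Set.indicator_of_mem hx, hx, and_true]
        constructor
        · intro h
          by_cases hr : ∃ j, φ j = d x
          · obtain ⟨j, hj⟩ := hr
            rw [← hj] at h ⊢
            simp only [e, hφ.injective.extend_apply, Nat.succ_eq_add_one] at h
            congr; omega
          · simp [e, Function.extend_apply' _ _ _ hr] at h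
        · intro h
          simp [e, h, hφ.injective.extend_apply]
      · simp [hx]
    rw [this]
    exact hP n

/-- Every set of positive measure supports an `L_p` function and a countable measurable partition
such that the function lies in no `L_q`, `q > p`, on any of the pieces. -/
theorem exists_memLp_forall_not_memLp_indicator (K : Type*) [RCLike K] [MetricSpace Ω]
    [SecondCountableTopology Ω] [BorelSpace Ω] [SigmaFinite μ] [NullSingletonClass μ] {p : ℝ≥0∞}
    (hp0 : p ≠ 0) (hp : p ≠ ∞) {B : Set Ω} (hB : MeasurableSet B) (hμB : μ B ≠ 0) :
    ∃ κ : Ω → ℕ, Measurable κ ∧ (∀ x, κ x ≠ 0 → x ∈ B) ∧ ∃ g : Ω → K, MemLp g p μ ∧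
      ∀ (k : ℕ) (q : ℝ≥0∞), p < q → ¬ MemLp ((κ ⁻¹' {k + 1}).indicator g) q μ := by
  obtain ⟨N, hN, hNB, hμN⟩ := exists_measurable_nat_measure_fiber_le hB hμB
    (fun n => (2⁻¹ : ℝ≥0∞) ^ (n * n)) (fun n => ENNReal.pow_pos (by simp) _)
  set a : ℕ → ℝ≥0∞ := fun n => μ (N ⁻¹' {n + 1}) with ha
  have ha0 : ∀ n, a n ≠ 0 := fun n => (hμN n).1.ne'
  have hat : ∀ n, a n ≠ ∞ := fun n =>
    ne_top_of_le_ne_top (ENNReal.pow_ne_top (by simp)) (hμN n).2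
  have hP : 0 < p.toReal := ENNReal.toReal_pos hp0 hp
  -- The value `c (n + 1)` makes the piece `N = n + 1` contribute exactly `2⁻ⁿ` to the integral of
  -- `|g|ᵖ`.
  let c : ℕ → ℝ≥0∞ := fun n => Nat.casesOn n 0 fun n => ((2⁻¹ : ℝ≥0∞) ^ n / a n) ^ p.toReal⁻¹
  have hct : ∀ n, c n ≠ ∞ := by
    rintro (_ | n)
    · exact ENNReal.zero_ne_top
    · exact ENNReal.rpow_ne_top_of_nonneg (by positivity)
        (ENNReal.div_ne_top (ENNReal.pow_ne_top (by simp)) (ha0 n))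
  -- Unpairing puts infinitely many pieces into each block.
  let e : ℕ → ℕ := fun n => Nat.casesOn n 0 fun n => n.unpair.1 + 1
  let g : Ω → K := fun x => (((c (N x)).toReal : ℝ) : K)
  have hg : ∀ x, ‖g x‖ₑ = c (N x) := by
    intro x
    rw [← ofReal_norm, RCLike.norm_ofReal, abs_of_nonneg ENNReal.toReal_nonneg,
      ENNReal.ofReal_toReal (hct _)]
  have hgm : Measurable g := (measurable_from_nat (f := fun n => (((c n).toReal : ℝ) : K))).comp hN
  refine ⟨fun x => e (N x), (measurable_from_nat (f := e)).comp hN,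
    fun x hx => hNB x fun h => hx (by simp [h, e]), g, ⟨hgm.aestronglyMeasurable, ?_⟩, ?_⟩
  · rw [eLpNorm_lt_top_iff_lintegral_rpow_enorm_lt_top hp0 hp]
    simp_rw [hg]
    rw [← lintegral_map (f := fun n => c n ^ p.toReal) measurable_from_nat hN, lintegral_countable']
    refine lt_of_le_of_lt (ENNReal.tsum_le_tsum (g := fun n => 2 * 2⁻¹ ^ n) ?_) ?_
    · rintro (_ | n)
      · simp [c, hP]
      · rw [Measure.map_apply hN (measurableSet_singleton _)]
        change (((2⁻¹ : ℝ≥0∞) ^ n / a n) ^ p.toReal⁻¹) ^ p.toReal * a n ≤ _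
        rw [ENNReal.rpow_inv_rpow hP.ne', ENNReal.div_mul_cancel (ha0 n) (hat n), pow_succ',
          ← mul_assoc, ENNReal.mul_inv_cancel two_ne_zero ENNReal.ofNat_ne_top, one_mul]
    · rw [ENNReal.tsum_mul_left, ENNReal.tsum_geometric]
      simp [ENNReal.mul_lt_top_iff]
  · intro k q hq hmem
    -- For `q = ∞` the convention `0⁻¹ = 0` gives the correct exponent `1/q = 0`.
    have hpq : q.toReal⁻¹ < p.toReal⁻¹ := by
      by_cases hqt : q = ∞
      · simpa [hqt] using hP
      · exact inv_strictAnti₀ hP ((ENNReal.toReal_lt_toReal hp hqt).2 hq)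
    set P := p.toReal⁻¹ with hPdef
    set Q := q.toReal⁻¹ with hQdef
    have hP' : 0 < P := by positivity
    have hlow : ∀ n : ℕ, n.unpair.1 = k → c (n + 1) * a n ^ Q ≤
        eLpNorm (((fun x => e (N x)) ⁻¹' {k + 1}).indicator g) q μ := by
      intro n hn
      have := eLpNorm_indicator_const' (μ := μ) (c := c (n + 1))
        (hN (measurableSet_singleton (n + 1))) (ha0 n) ((zero_le (a := p)).trans_lt hq).ne'
      rw [one_div] at this
      change _ = c (n + 1) * a n ^ Q at this
      rw [← this]
      refine eLpNorm_mono_enorm fun x => ?_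
      by_cases hx : N x = n + 1
      · rw [Set.indicator_of_mem (by simpa using hx), Set.indicator_of_mem (by simp [hx, e, hn]),
          hg, hx]
        simp
      · rw [Set.indicator_of_notMem (by simpa using hx)]
        simp
    -- The left side is `2^(-Pn) * a n ^ (Q - P)`, and `a n ≤ 2^(-n²)` makes the second factor at
    -- least `2^(n²(P - Q)) ≥ 2^(2Pn)` past the threshold.
    have hlarge : ∀ n : ℕ, 2 * P ≤ n * (P - Q) → ((2 : ℝ≥0∞) ^ P) ^ n ≤ c (n + 1) * a n ^ Q := by
      intro n hn
      have hpow : ∀ j : ℕ, (2⁻¹ : ℝ≥0∞) ^ j = 2 ^ (-(j : ℝ)) := fun j => by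
        rw [ENNReal.rpow_neg, ENNReal.rpow_natCast, ENNReal.inv_pow]
      have h1 : a n ^ (P - Q) ≤ 2 ^ (-(2 * P * n)) := by
        refine (ENNReal.rpow_le_rpow (hμN n).2 (sub_pos.2 hpq).le).trans ?_
        rw [hpow, ← ENNReal.rpow_mul]
        refine ENNReal.rpow_le_rpow_of_exponent_le ENNReal.one_lt_two.le ?_
        have := mul_le_mul_of_nonneg_right hn (Nat.cast_nonneg (α := ℝ) n)
        push_cast
        linarith
      change _ ≤ ((2⁻¹ : ℝ≥0∞) ^ n / a n) ^ P * a n ^ Q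
      have h2 : ((2⁻¹ : ℝ≥0∞) ^ n / a n) ^ P * a n ^ Q =
          2 ^ (-(P * n)) * (a n ^ (P - Q))⁻¹ := by
        rw [ENNReal.div_rpow_of_nonneg _ _ hP'.le, div_eq_mul_inv, ← ENNReal.rpow_neg, mul_assoc,
          ← ENNReal.rpow_add _ _ (ha0 n) (hat n), ← ENNReal.rpow_neg, hpow, ← ENNReal.rpow_mul]
        congr 2 <;> ring
      rw [h2, ← ENNReal.rpow_natCast, ← ENNReal.rpow_mul]
      refine le_trans (le_of_eq ?_) (mul_le_mul_right (ENNReal.inv_le_inv.2 h1) _)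
      rw [← ENNReal.rpow_neg, ← ENNReal.rpow_add _ _ two_ne_zero ENNReal.ofNat_ne_top]
      congr 1
      ring
    have h2 : (1 : ℝ≥0∞) < 2 ^ P := ENNReal.one_lt_rpow ENNReal.one_lt_two hP'
    have hT := ENNReal.tendsto_pow_atTop_nhds_top_iff.2 h2
    obtain ⟨M, hM⟩ := eventually_atTop.1 ((hT.eventually (lt_mem_nhds hmem.2)).and
      ((tendsto_natCast_atTop_atTop.atTop_mul_const (sub_pos.2 hpq)).eventually_ge_atTop (2 * P)))
    -- The index `Nat.pair k M` belongs to block `k` and is at least `M`.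
    obtain ⟨h3, h4⟩ := hM (Nat.pair k M) (Nat.right_le_pair k M)
    exact absurd ((hlarge _ h4).trans (hlow _ (by simp))) h3.not_ge

end UnboundedFunctions

/-! ### Bounded functions, and the closed subspace spread over the blocks. -/

section BlockSubspace

variable {Ω : Type*} [MeasurableSpace Ω] {μ : Measure Ω} {K : Type*} [RCLike K] {p : ℝ≥0∞}

/-- For finite `q`, `|f|^q ≤ M^(q-p) |f|^p`. -/
theorem memLp_of_memLp_of_bound {f : Ω → K} {q : ℝ≥0∞} (hf : MemLp f p μ) (hp0 : p ≠ 0)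
    (hpq : p ≤ q) {M : ℝ} (hM : ∀ᵐ x ∂μ, ‖f x‖ ≤ M) : MemLp f q μ := by
  by_cases hq : q = ∞
  · exact hq ▸ memLp_top_of_bound hf.1 M hM
  have hp : p ≠ ∞ := ne_top_of_le_ne_top hq hpq
  have hq0 : q ≠ 0 := fun h => hp0 (le_zero_iff.1 (h ▸ hpq))
  have hpq' : p.toReal ≤ q.toReal := ENNReal.toReal_mono hq hpq
  refine ⟨hf.1, ?_⟩
  rw [eLpNorm_lt_top_iff_lintegral_rpow_enorm_lt_top hq0 hq]
  have hint := (eLpNorm_lt_top_iff_lintegral_rpow_enorm_lt_top hp0 hp).1 hf.2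
  have hC : ENNReal.ofReal M ^ (q.toReal - p.toReal) ≠ ∞ :=
    ENNReal.rpow_ne_top_of_nonneg (sub_nonneg.2 hpq') ENNReal.ofReal_ne_top
  refine lt_of_le_of_lt (lintegral_mono_ae ?_) ((lintegral_const_mul' (ENNReal.ofReal M ^
    (q.toReal - p.toReal)) _ hC).trans_lt (ENNReal.mul_lt_top hC.lt_top hint))
  filter_upwards [hM] with x hx
  calc ‖f x‖ₑ ^ q.toReal = ‖f x‖ₑ ^ (q.toReal - p.toReal) * ‖f x‖ₑ ^ p.toReal := by
        rw [← ENNReal.rpow_add_of_nonneg _ _ (sub_nonneg.2 hpq') ENNReal.toReal_nonneg,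
          sub_add_cancel]
    _ ≤ _ := by
        gcongr
        rw [← ofReal_norm]
        exact ENNReal.ofReal_le_ofReal hx

/-- All members of a finite dimensional space of functions are bounded on a common set of positive
measure. -/
theorem exists_measurableSet_forall_bounded [NeZero μ] (F : Submodule K (Lp K p μ)) (hF : F.FG) :
    ∃ B : Set Ω, MeasurableSet B ∧ μ B ≠ 0 ∧ ∀ f ∈ F, ∃ M : ℝ, ∀ᵐ x ∂μ, x ∈ B → ‖f x‖ ≤ M := by
  obtain ⟨s, rfl⟩ := hF
  let B : ℕ → Set Ω := fun n => ⋂ f ∈ s, {x | ‖(f : Ω → K) x‖ ≤ n}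
  have hB : ∀ n, MeasurableSet (B n) := fun n => Finset.measurableSet_biInter _ fun f _ =>
    measurableSet_le (Lp.stronglyMeasurable f).measurable.norm measurable_const
  obtain ⟨n, hn⟩ : ∃ n, μ (B n) ≠ 0 := by
    by_contra! h
    refine NeZero.ne μ (Measure.measure_univ_eq_zero.1 (measure_mono_null ?_
      (measure_iUnion_null h)))
    intro x _
    obtain ⟨n, hn⟩ := exists_nat_ge (∑ f ∈ s, ‖(f : Ω → K) x‖)
    refine Set.mem_iUnion.2 ⟨n, Set.mem_iInter₂.2 fun f hf => le_trans ?_ hn⟩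
    exact Finset.single_le_sum (f := fun f : Lp K p μ => ‖(f : Ω → K) x‖)
      (fun _ _ => norm_nonneg _) hf
  refine ⟨B n, hB n, hn, fun f hf => ?_⟩
  induction hf using Submodule.span_induction with
  | mem f hf => exact ⟨n, .of_forall fun x hx => Set.mem_iInter₂.1 hx f hf⟩
  | zero =>
    refine ⟨0, ?_⟩
    filter_upwards [Lp.coeFn_zero K p μ] with x hx _
    rw [hx, Pi.zero_apply, norm_zero]
  | add f g _ _ hf hg =>
    obtain ⟨M, hM⟩ := hf
    obtain ⟨M', hM'⟩ := hg
    refine ⟨M + M', ?_⟩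
    filter_upwards [hM, hM', Lp.coeFn_add f g] with x h1 h2 h3 hx
    rw [h3]
    exact (norm_add_le _ _).trans (add_le_add (h1 hx) (h2 hx))
  | smul a f _ hf =>
    obtain ⟨M, hM⟩ := hf
    refine ⟨‖a‖ * M, ?_⟩
    filter_upwards [hM, Lp.coeFn_smul a f] with x h1 h3 hx
    rw [h3, Pi.smul_apply, norm_smul]
    exact mul_le_mul_of_nonneg_left (h1 hx) (norm_nonneg _)

theorem mem_lpMinusUnion_iff {f : Lp K p μ} :
    f ∈ lpMinusUnion K p μ ↔ ∀ q, p < q → ¬ MemLp f q μ := by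
  simp [lpMinusUnion, Lp.mem_Lp_iff_memLp]

variable {κ : Ω → ℕ} (hκ : Measurable κ)

/-- Restriction of an `L_p` function to a level set of `κ`. -/
noncomputable def lpFiber (hκ : Measurable κ) (k : ℕ) : Lp K p μ →ₗ[K] Lp K p μ :=
  lpIndicator K (hκ (measurableSet_singleton k))

theorem coeFn_lpFiber (k : ℕ) (f : Lp K p μ) :
    ⇑(lpFiber hκ k f) =ᵐ[μ] (κ ⁻¹' {k}).indicator f :=
  coeFn_lpIndicator _ f

theorem memLp_lpFiber {q : ℝ≥0∞} (k : ℕ) {f : Lp K p μ} (hf : MemLp f q μ) :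
    MemLp (lpFiber hκ k f) q μ :=
  (memLp_congr_ae (coeFn_lpFiber hκ k f)).2 (hf.indicator (hκ (measurableSet_singleton k)))

theorem eq_of_forall_lpFiber_eq {f g : Lp K p μ} (h : ∀ k, lpFiber hκ k f = lpFiber hκ k g) :
    f = g := by
  refine Lp.ext ?_
  have hf := ae_all_iff.2 fun k => coeFn_lpFiber hκ k f
  have hg := ae_all_iff.2 fun k => coeFn_lpFiber hκ k g
  filter_upwards [hf, hg] with x h1 h2
  have := (h1 (κ x)).symm.trans ((congrArg (fun u : Lp K p μ => u x) (h (κ x))).trans (h2 (κ x)))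
  simpa using this

/-- The `L_p` functions that vanish where `κ = 0`, and are a multiple of `g` on each of the other
level sets of `κ`. -/
noncomputable def blockSubspace (hκ : Measurable κ) (g : Lp K p μ) : Submodule K (Lp K p μ) :=
  (lpFiber hκ 0).ker ⊓ ⨅ k : ℕ, (K ∙ lpFiber hκ (k + 1) g).comap (lpFiber hκ (k + 1))

theorem mem_blockSubspace {f g : Lp K p μ} : f ∈ blockSubspace hκ g ↔
    lpFiber hκ 0 f = 0 ∧ ∀ k, ∃ c : K, c • lpFiber hκ (k + 1) g = lpFiber hκ (k + 1) f := by
  simp [blockSubspace, Submodule.mem_span_singleton]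

/-- Each condition is the preimage of `0` or of a line, both closed, under a continuous restriction
map. -/
theorem isClosed_blockSubspace (hp : p ≠ 0) (g : Lp K p μ) :
    @IsClosed _ (lpTopology K p μ) (blockSubspace hκ g : Set (Lp K p μ)) := by
  let _ := lpTopology K p μ
  have _ := lpTopology_isTopologicalAddGroup K p μ
  have _ := lpTopology_t2Space K p μ hp
  have _ := lpTopology_continuousSMul K p μ
  have hc : ∀ k, Continuous (lpFiber (K := K) (p := p) (μ := μ) hκ k) := fun k =>
    continuous_lpIndicator K p μ _
  rw [blockSubspace, Submodule.coe_inf, Submodule.coe_iInf]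
  refine IsClosed.inter (isClosed_singleton.preimage (hc 0)) (isClosed_iInter fun k => ?_)
  exact (Submodule.closed_of_finiteDimensional (K ∙ lpFiber hκ (k + 1) g)).preimage (hc (k + 1))

/-- A member is determined by its sequence of coefficients, so the space itself has at most `𝔠`
elements. -/
theorem rank_blockSubspace_le (g : Lp K p μ) : Module.rank K (blockSubspace hκ g) ≤ 𝔠 := by
  have hmem := fun f : blockSubspace hκ g => ((mem_blockSubspace hκ).1 f.2).2
  choose c hc using hmem
  have hinj : Function.Injective fun f k => (RCLike.re (c f k), RCLike.im (c f k)) := by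
    intro f f' h
    have h' : c f = c f' := funext fun k =>
      RCLike.ext (congrArg Prod.fst (congrFun h k)) (congrArg Prod.snd (congrFun h k))
    refine Subtype.ext (eq_of_forall_lpFiber_eq hκ ?_)
    rintro (_ | k)
    · rw [((mem_blockSubspace hκ).1 f.2).1, ((mem_blockSubspace hκ).1 f'.2).1]
    · rw [← hc f k, ← hc f' k, h']
  have h1 := Cardinal.lift_mk_le_lift_mk_of_injective hinj
  rw [Cardinal.lift_uzero] at h1
  refine (rank_le_card K _).trans (h1.trans ?_)
  simp [Cardinal.mk_real]

/-- The coefficient sequences `k ↦ t^k`, for `t` in `(0, 1)`, are distinct characters of the monoid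
`ℕ`, so they are linearly independent by Dedekind's lemma. -/
theorem continuum_le_rank_blockSubspace {g : Lp K p μ}
    (hg : ∀ k, lpFiber hκ (k + 1) g ≠ 0) : 𝔠 ≤ Module.rank K (blockSubspace hκ g) := by
  let ψ : Set.Ioo (0 : ℝ) 1 → ℕ → K := fun t n => Nat.casesOn n 0 fun k => ((t : ℝ) : K) ^ k
  have hψ : ∀ t n, ‖ψ t n‖ ≤ 1 := by
    rintro t (_ | n)
    · simp [ψ]
    · simp only [ψ, norm_pow, RCLike.norm_ofReal]
      exact pow_le_one₀ (abs_nonneg _) (abs_le.2 ⟨by linarith [t.2.1], t.2.2.le⟩)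
  have hψm : ∀ t, MemLp (fun x => ψ t (κ x) * g x) p μ := fun t =>
    (Lp.memLp g).of_le (((measurable_from_nat (f := ψ t)).comp hκ).aestronglyMeasurable.mul
      (Lp.aestronglyMeasurable g)) (.of_forall fun x => by
        rw [norm_mul]
        exact mul_le_of_le_one_left (norm_nonneg _) (hψ t _))
  have hfib : ∀ t k, lpFiber hκ k ((hψm t).toLp _) = ψ t k • lpFiber hκ k g := by
    intro t k
    refine Lp.ext ?_
    filter_upwards [coeFn_lpFiber hκ k ((hψm t).toLp _), (hψm t).coeFn_toLp,
      Lp.coeFn_smul (ψ t k) (lpFiber hκ k g), coeFn_lpFiber hκ k g] with x h1 h2 h3 h4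
    rw [h1, h3, Pi.smul_apply, h4]
    by_cases hx : κ x = k
    · rw [Set.indicator_of_mem (by simpa using hx), Set.indicator_of_mem (by simpa using hx), h2,
        hx, smul_eq_mul]
    · simp [hx]
  have hmem : ∀ t, (hψm t).toLp _ ∈ blockSubspace hκ g := fun t =>
    (mem_blockSubspace hκ).2 ⟨by rw [hfib]; simp [ψ], fun k => ⟨ψ t (k + 1), (hfib t (k + 1)).symm⟩⟩
  have hpow : LinearIndependent K
      fun (t : Set.Ioo (0 : ℝ) 1) (k : Multiplicative ℕ) => ((t : ℝ) : K) ^ k.toAdd := by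
    refine (linearIndependent_monoidHom (Multiplicative ℕ) K).comp
      (fun t : Set.Ioo (0 : ℝ) 1 => powersHom K ((t : ℝ) : K)) fun t t' h => ?_
    exact Subtype.ext (RCLike.ofReal_injective ((powersHom K).injective h))
  have hli : LinearIndependent K fun t => (⟨_, hmem t⟩ : blockSubspace hκ g) := by
    rw [linearIndependent_iff'] at hpow ⊢
    intro s l hl t ht
    refine hpow s l (funext fun k => ?_) t ht
    have h1 := congrArg (fun f : blockSubspace hκ g => lpFiber hκ (k.toAdd + 1) (f : Lp K p μ)) hl
    simp only [Submodule.coe_sum, Submodule.coe_smul, map_sum, map_smul, hfib, smul_smul,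
      ← Finset.sum_smul, ZeroMemClass.coe_zero, map_zero] at h1
    simpa [ψ] using (smul_eq_zero.1 h1).resolve_right (hg _)
  have := hli.cardinal_lift_le_rank
  rwa [Cardinal.mk_Ioo_real one_pos, Cardinal.lift_continuum, Cardinal.continuum_le_lift] at this

end BlockSubspace

/-! ### Enlarging finite dimensional subspaces. -/

section Spaceability

variable {Ω : Type*} [MeasurableSpace Ω] {μ : Measure Ω} {K : Type*} [RCLike K] {p : ℝ≥0∞}

/-- If the functions in `F` are bounded on the union of the blocks of `κ` and `g` is in no `L_q` on
each of the blocks, then adding the block subspace to `F` does not produce functions in `L_q`. -/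
theorem sup_blockSubspace_subset {κ : Ω → ℕ} (hκ : Measurable κ) (hp0 : p ≠ 0)
    {F : Submodule K (Lp K p μ)} (hF : (F : Set (Lp K p μ)) ⊆ lpMinusUnion K p μ ∪ {0})
    (hb : ∀ f ∈ F, ∃ M : ℝ, ∀ᵐ x ∂μ, κ x ≠ 0 → ‖f x‖ ≤ M) {g : Lp K p μ}
    (hg : ∀ (k : ℕ) (q : ℝ≥0∞), p < q → ¬ MemLp (lpFiber hκ (k + 1) g) q μ) :
    ((blockSubspace hκ g ⊔ F : Submodule K (Lp K p μ)) : Set (Lp K p μ)) ⊆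
      lpMinusUnion K p μ ∪ {0} := by
  intro h hh
  obtain ⟨u, hu, f, hf, rfl⟩ := Submodule.mem_sup.1 hh
  obtain ⟨hu0, huk⟩ := (mem_blockSubspace hκ).1 hu
  rw [Set.mem_union, or_iff_not_imp_right]
  intro hne
  refine mem_lpMinusUnion_iff.2 fun q hq hmem => hne ?_
  -- Otherwise `f` is in no `L_q`; but it equals `u + f` off the blocks and is bounded on them.
  have hf0 : f = 0 := by
    refine (hF hf).resolve_left fun hfA => mem_lpMinusUnion_iff.1 hfA q hq ?_
    have h1 : MemLp (lpFiber hκ 0 f) q μ := by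
      simpa [hu0] using memLp_lpFiber hκ 0 hmem
    have h2 : MemLp ((κ ⁻¹' {0})ᶜ.indicator f) q μ := by
      obtain ⟨M, hM⟩ := hb f hf
      refine memLp_of_memLp_of_bound (M := max M 0)
        ((Lp.memLp f).indicator (hκ (measurableSet_singleton 0)).compl) hp0 hq.le ?_
      filter_upwards [hM] with x hx
      by_cases hx0 : κ x = 0
      · simp [hx0]
      · rw [Set.indicator_of_mem (by simpa using hx0)]
        exact (hx hx0).trans (le_max_left _ _)
    refine (memLp_congr_ae ?_).1 (h1.add h2)
    filter_upwards [coeFn_lpFiber hκ 0 f] with x hx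
    rw [Pi.add_apply, hx, Set.indicator_self_add_compl_apply]
  subst hf0
  rw [add_zero] at hmem ⊢
  refine eq_of_forall_lpFiber_eq hκ ?_
  rintro (_ | k)
  · rw [hu0, map_zero]
  · obtain ⟨c, hc⟩ := huk k
    rw [map_zero, ← hc]
    by_cases hc0 : c = 0
    · rw [hc0, zero_smul]
    · have h1 := memLp_lpFiber hκ (k + 1) hmem
      rw [← hc] at h1
      refine absurd ?_ (hg k q hq)
      refine (memLp_congr_ae ?_).1 (h1.const_smul c⁻¹)
      filter_upwards [Lp.coeFn_smul c (lpFiber hκ (k + 1) g)] with x hx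
      rw [Pi.smul_apply, hx, Pi.smul_apply, inv_smul_smul₀ hc0]

variable [MetricSpace Ω] [SecondCountableTopology Ω] [BorelSpace Ω] [SigmaFinite μ]
  [NullSingletonClass μ] [NeZero μ]

/-- Every finite dimensional subspace of `lpMinusUnion ∪ {0}` lies in a closed subspace of dimension
`𝔠` of that set. -/
theorem exists_isClosed_continuum_rank (hp0 : p ≠ 0) (hp : p ≠ ∞)
    (F : Submodule K (Lp K p μ)) (hFG : F.FG)
    (hF : (F : Set (Lp K p μ)) ⊆ lpMinusUnion K p μ ∪ {0}) :
    ∃ F' : Submodule K (Lp K p μ), Module.rank K F' = 𝔠 ∧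
      @IsClosed _ (lpTopology K p μ) (F' : Set (Lp K p μ)) ∧ F ≤ F' ∧
      (F' : Set (Lp K p μ)) ⊆ lpMinusUnion K p μ ∪ {0} := by
  obtain ⟨B, hB, hμB, hbd⟩ := exists_measurableSet_forall_bounded F hFG
  obtain ⟨κ, hκ, hκB, g, hg, hgq⟩ :=
    exists_memLp_forall_not_memLp_indicator K hp0 hp hB hμB
  have hfib : ∀ (k : ℕ) (q : ℝ≥0∞), p < q → ¬ MemLp (lpFiber hκ (k + 1) (hg.toLp g)) q μ := by
    intro k q hq h
    refine hgq k q hq ((memLp_congr_ae ?_).1 h)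
    filter_upwards [coeFn_lpFiber hκ (k + 1) (hg.toLp g), hg.coeFn_toLp] with x h1 h2
    rw [h1]
    by_cases hx : κ x = k + 1
    · rw [Set.indicator_of_mem (by simpa using hx), Set.indicator_of_mem (by simpa using hx), h2]
    · simp [hx]
  have hne : ∀ k, lpFiber hκ (k + 1) (hg.toLp g) ≠ 0 := fun k h0 =>
    hfib k ∞ hp.lt_top (by rw [h0]; exact (memLp_congr_ae (Lp.coeFn_zero K p μ)).2 MemLp.zero)
  have _ : FiniteDimensional K F := Module.Finite.iff_fg.2 hFG
  refine ⟨blockSubspace hκ (hg.toLp g) ⊔ F, le_antisymm ?_ ?_, ?_, le_sup_right,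
    sup_blockSubspace_subset hκ hp0 hF (fun f hf => ?_) hfib⟩
  · refine (Submodule.rank_add_le_rank_add_rank _ _).trans ?_
    refine Cardinal.add_le_of_le Cardinal.aleph0_le_continuum (rank_blockSubspace_le hκ _) ?_
    exact (Module.rank_lt_aleph0 K F).le.trans Cardinal.aleph0_le_continuum
  · exact (continuum_le_rank_blockSubspace hκ hne).trans (Submodule.rank_mono le_sup_left)
  · let _ := lpTopology K p μ
    have _ := lpTopology_isTopologicalAddGroup K p μ
    have _ := lpTopology_continuousSMul K p μ
    exact Submodule.isClosed_sup_finiteDimensional _ _ (isClosed_blockSubspace hκ hp0 _)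
  · obtain ⟨M, hM⟩ := hbd f hf
    exact ⟨M, hM.mono fun x hx h => hx (hκB x h)⟩

theorem isPairSpaceable_lpMinusUnion (hp0 : p ≠ 0) (hp : p ≠ ∞) (n : ℕ) :
    @IsPairSpaceable K _ _ _ _ (lpTopology K p μ) n 𝔠 (lpMinusUnion K p μ) := by
  refine ⟨?_, fun F hF hrank => exists_isClosed_continuum_rank hp0 hp F ?_ hF⟩
  -- Lineability follows by enlarging the zero subspace to dimension `𝔠` and choosing an
  -- `n`-dimensional subspace of the result.
  · obtain ⟨G, hG, -, -, hGA⟩ := exists_isClosed_continuum_rank (K := K) (μ := μ) hp0 hp ⊥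
      Submodule.fg_bot (by simp)
    have hn : (n : Cardinal) ≤ Module.rank K G := by
      rw [hG]
      exact (Cardinal.natCast_lt_aleph0.trans Cardinal.aleph0_lt_continuum).le
    obtain ⟨v, hv⟩ := Module.le_rank_iff_exists_linearMap.1 hn
    refine ⟨LinearMap.range (G.subtype ∘ₗ v), ?_, ?_⟩
    · have h := lift_rank_range_of_injective (G.subtype ∘ₗ v) (G.injective_subtype.comp hv)
      simpa using h
    · rintro _ ⟨⟨x, rfl⟩, hx⟩
      exact (hGA (v x).2).resolve_right hx
  · refine Module.Finite.iff_fg.1 (Module.rank_lt_aleph0_iff.1 ?_)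
    rw [hrank]
    exact Cardinal.natCast_lt_aleph0

end Spaceability

/-! ### The equivalence for Lebesgue measure. -/

theorem mainTheorem7 (K : Type*) [RCLike K] (m : ℕ) (hm : 1 ≤ m) (p : ℝ≥0∞) (hp0 : 0 < p)
    (hp : p < ∞) (X : Set (EuclideanSpace ℝ (Fin m))) (hX : NullMeasurableSet X volume) :
    letI : TopologicalSpace (Lp K p (volume.restrict X)) := lpTopology K p (volume.restrict X)
    List.TFAE [
      0 < volume X,
      ∃ n : ℕ, IsPairSpaceable K (n : Cardinal) 𝔠 (lpMinusUnion K p (volume.restrict X)),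
      ∀ α : Cardinal, α < ℵ₀ →
        IsPairSpaceable K α 𝔠 (lpMinusUnion K p (volume.restrict X)),
      IsCardSpaceable K 𝔠 (lpMinusUnion K p (volume.restrict X)),
      IsCardLineable K 𝔠 (lpMinusUnion K p (volume.restrict X))] := by
  have : Nonempty (Fin m) := ⟨⟨0, hm⟩⟩
  have : Nontrivial (EuclideanSpace ℝ (Fin m)) := inferInstance
  tfae_have 1 → 3 := by
    intro hpos α hα
    have : NeZero (volume.restrict X) := ⟨fun h => hpos.ne' (Measure.restrict_eq_zero.1 h)⟩
    obtain ⟨n, rfl⟩ := Cardinal.lt_aleph0.1 hα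
    exact isPairSpaceable_lpMinusUnion hp0.ne' hp.ne n
  tfae_have 3 → 2 := fun h => ⟨0, h _ Cardinal.natCast_lt_aleph0⟩
  tfae_have 2 → 4 := by
    rintro ⟨n, ⟨F, hF, hFA⟩, h⟩
    obtain ⟨F', h1, h2, -, h3⟩ := h F (fun f hf => by
      by_cases h0 : f = 0
      · exact Or.inr h0
      · exact Or.inl (hFA ⟨hf, h0⟩)) hF
    exact ⟨F', h1, h2, h3⟩
  tfae_have 4 → 5 := by
    rintro ⟨F, h1, -, h2⟩
    exact ⟨F, h1, fun f hf => (h2 hf.1).resolve_right hf.2⟩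
  tfae_have 5 → 1 := by
    rintro ⟨F, hF, -⟩
    rw [pos_iff_ne_zero]
    intro h0
    have hμ : volume.restrict X = 0 := Measure.restrict_eq_zero.2 h0
    have : Subsingleton (Lp K p (volume.restrict X)) :=
      ⟨fun f g => Lp.ext (by simp [hμ, Filter.EventuallyEq])⟩
    rw [rank_subsingleton'] at hF
    exact Cardinal.continuum_ne_zero hF.symm
  tfae_finish
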